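/- **Setting.** Terms are built from variables, the uninterpreted unary symbol $f$ and the interpreted symbols $0,s,p$, which are interpreted over $\mathbb Z$ by $0$, $x\mapsto x+1$, $x\mapsto x-1$; the predicate symbols are $\simeq,>,\ge$ with their usual meaning. Let $R_1$ be the constrained term rewriting system defining the McCarthy 91 function: $$f(x)\to f(f(s^{11}(x)))\ [\,s^{101}(0)>x\,],\qquad f(x)\to p^{10}(x)\ [\,\neg(s^{101}(0)>x)\,],\qquad s(p(x))\to x,\qquad p(s(x))\to x .$$ A rule $\ell\to r\ [\varphi]$ rewrites $C[\ell\sigma]$ to $C[r\sigma]$ for every context $C$ and every substitution $\sigma$ that maps the variables of $\varphi$ to terms over $0,s,p$ and variables and for which $\varphi\sigma$ is valid, i.e. all its ground instances over $0,s,p$ hold in $\mathbb Z$. The defined symbols (roots of left-hand sides) are $f,s,p$; for each of them there is a marked copy $f^\sharp,s^\sharp,p^\sharp$. A dependency pair of $R_1$ is a triple $g^\sharp(\vec u)\to h^\sharp(\vec w)\ [\varphi]$ such that $g,h$ are defined symbols and $g(\vec u)\to C[h(\vec w)]\ [\varphi]$ is a renamed variant of a rule of $R_1$ for some context $C$. For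 a set $S$ of dependency pairs, an $(S,R_1)$-chain is a finite or infinite derivation $$s_0^\sharp\sigma_0\to_S t_0^\sharp\sigma_0\to_{R_1}^* s_1^\sharp\sigma_1\to_S t_1^\sharp\sigma_1\to_{R_1}^*\cdots$$ where $s_i^\sharp\to t_i^\sharp\ [\varphi_i]$ is in $S$ and is applied at the root under the same condition on $\sigma_i$ and $\varphi_i$ as for rules, the $R_1$-steps are below the root, and every $t_i^\sharp\sigma_i$ is terminating with respect to $R_1$. It is infinite if it has infinitely many $S$-steps, and ground if all its terms are ground. A linear polynomial interpretation $\mathcal Pol$ assigns to $f$ and to the marked symbols linear polynomials over $\mathbb Z$; it extends to all terms, with $0,s,p$ keeping their meaning. **Claim.** 1. $R_1$ is terminating: no term starts an infinite $R_1$-reduction. 2. Up to renaming of variables, the dependency pairs of $R_1$ are exactly - (3) $f^\sharp(x)\to f^\sharp(f(s^{11}(x)))\ [s^{101}(0)>x]$, - (4) $f^\sharp(x)\to f^\sharp(s^{11}(x))\ [s^{101}(0)>x]$, - (5) $f^\sharp(x)\to s^\sharp(s^i(x))\ [s^{101}(0)>x]$ for $0\le i\le 10$, - (6) $f^\sharp(x)\to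 p^\sharp(p^i(x))\ [\neg(s^{101}(0)>x)]$ for $0\le i\le 9$. 3. Consider the dependency graph with the pairs (3)–(6) as nodes and an edge from one pair to another if they form, in this order, a chain with two pairs. Its only strongly connected component that contains a cycle is $S=\{(3),(4)\}$. 4. Let $\mathcal Pol$ be a linear polynomial interpretation with $\mathcal Pol(f^\sharp)=-1-x_1$ and $\mathcal Pol(f)=-10+x_1$. Then the conditions for applying the processor $\mathrm{Proc}_{PI}^{(>,\le,\le)}$ to $(S,R_1)$ hold: - in right-hand sides of rules in $R_1$ and pairs in $S$, the second argument of a subtraction symbol is always a term over the interpreted symbols and the variables of the constraint (here trivially, since there is no subtraction symbol); - the coefficients of variables in $\mathcal Pol(f)$ are non-negative; - $\varphi\Rightarrow\mathcal Pol(\ell)\le\mathcal Pol(r)$ is valid for every rule $\ell\to r\ [\varphi]$ of $R_1$; - in $\mathcal Pol(g^\sharp)$ the coefficient of $x_i$ is $\le 0$ for every position $i$ for which $S$ contains a pair $s^\sharp\to g^\sharp(t_1,\dots,t_n)\ [\varphi]$ such that $t_i$ is not a term over the interpreted symbols and the variables of $\varphi$; - $\varphi\Rightarrow\mathcal Pol(s^\sharp)\ge\mathcal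 Pol(t^\sharp)$ is valid for every pair $s^\sharp\to t^\sharp\ [\varphi]$ of $S$. Moreover, let $S_>$ be the set of pairs of $S$ for which $\varphi\Rightarrow\mathcal Pol(s^\sharp)>\mathcal Pol(t^\sharp)$ is valid, and $S_{\mathrm{bound}}$ the set of pairs of $S$ for which $\varphi\Rightarrow\mathcal Pol(s^\sharp)\ge c_0$ is valid for some ground term $c_0$ over $0,s,p$. Then $S_>=S_{\mathrm{bound}}=S$, so that $\mathrm{Proc}_{PI}^{(>,\le,\le)}(S,R_1)=\{S\setminus S_>,\,S\setminus S_{\mathrm{bound}}\}=\{\emptyset\}$. Finally, there is an integer $c$ such that every ground $(S,R_1)$-chain, finite or infinite, satisfies $$\mathcal Pol(s_0^\sharp\sigma_0)>\mathcal Pol(t_0^\sharp\sigma_0)\ge\mathcal Pol(s_1^\sharp\sigma_1)>\mathcal Pol(t_1^\sharp\sigma_1)\ge\cdots\qquad\text{and}\qquad \mathcal Pol(s_i^\sharp\sigma_i)\ge c\ \text{ for all } i.$$ In particular, along an infinite ground chain there would be infinitely many strict decreases. 5. There is no infinite $(S,R_1)$-chain, ground or not. -/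

import Mathlib

namespace CTRS

open FirstOrder FirstOrder.Language

/-! ### Terms, contexts, rules -/

/-- Terms in `T(F ∪ G, V)` with `V = ℕ`. `F` holds the uninterpreted function symbols, `G` the
interpreted ones; the relation symbols of `G` are the predicate symbols. -/
abbrev Tm (F G : FirstOrder.Language.{0, 0}) : Type := (F.sum G).Term ℕ

/-- Substitutions in `Sub(F ∪ G, V)`. -/
abbrev Sub (F G : FirstOrder.Language.{0, 0}) : Type := ℕ → Tm F G

/-- The inclusion of `T(G, V)` in `T(F ∪ G, V)`. -/
def embed {F G : FirstOrder.Language.{0, 0}} (t : G.Term ℕ) : Tm F G :=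
  (LHom.sumInr : G →ᴸ F.sum G).onTerm t

/-- `t ∈ T(G, W)`. -/
def IsInterpreted {F G : FirstOrder.Language.{0, 0}} (t : Tm F G) (W : Finset ℕ) : Prop :=
  ∃ t' : G.Term ℕ, embed t' = t ∧ t'.varFinset ⊆ W

/-- Contexts: terms with exactly one hole. In `arg f i ts C` the `i`-th argument of `f` is `C`, the
other arguments are taken from `ts`. -/
inductive Ctx (F G : FirstOrder.Language.{0, 0}) : Type
  | hole : Ctx F G
  | arg {n : ℕ} (f : (F.sum G).Functions n) (i : Fin n) (ts : Fin n → Tm F G) (C : Ctx F G) : Ctx F G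

/-- `C[t]`. -/
def Ctx.fill {F G : FirstOrder.Language.{0, 0}} : Ctx F G → Tm F G → Tm F G
  | .hole, t => t
  | .arg f i ts C, t => Term.func f (Function.update ts i (C.fill t))

/-- A triple `lhs → rhs [cond]`. -/
structure CRule (F G : FirstOrder.Language.{0, 0}) where
  lhs : Tm F G
  rhs : Tm F G
  cond : G.Formula ℕ

/-- The conditions that make a triple a constrained rewrite rule. -/
structure CRule.WellFormed {F G : FirstOrder.Language.{0, 0}} (ρ : CRule F G) : Prop where
  lhs_not_var : ∀ x, ρ.lhs ≠ Term.var x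
  quantifierFree : ρ.cond.IsQF
  rhs_vars : ρ.rhs.varFinset ⊆ ρ.lhs.varFinset
  cond_vars : ρ.cond.freeVarFinset ⊆ ρ.lhs.varFinset

/-- The renamed variant of a rule along a bijective renaming of the variables. -/
def CRule.rename {F G : FirstOrder.Language.{0, 0}} (ρ : CRule F G) (π : Equiv.Perm ℕ) : CRule F G where
  lhs := ρ.lhs.subst fun x => Term.var (π x)
  rhs := ρ.rhs.subst fun x => Term.var (π x)
  cond := ρ.cond.subst fun x => Term.var (π x)

/-! ### Constrained rewriting over a structure with universe `ℤ` -/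

/-- Validity of a constraint: every ground instance over `G` holds in the structure. -/
def Valid {G : FirstOrder.Language.{0, 0}} [G.Structure ℤ] (φ : G.Formula ℕ) : Prop :=
  ∀ θ : ℕ → G.Term Empty, ℤ ⊨ (φ.subst θ : G.Sentence)

/-- `σ|Var(φ) ∈ Sub(G, V)` and `φσ` is valid. -/
def Satisfies {F G : FirstOrder.Language.{0, 0}} [G.Structure ℤ] (σ : Sub F G) (φ : G.Formula ℕ) : Prop :=
  ∃ τ : ℕ → G.Term ℕ, (∀ x ∈ φ.freeVarFinset, σ x = embed (τ x)) ∧ Valid (φ.subst τ)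

/-- The rewrite relation of `R`. -/
def Step {F G : FirstOrder.Language.{0, 0}} [G.Structure ℤ] (R : Set (CRule F G)) (s t : Tm F G) : Prop :=
  ∃ ρ ∈ R, ∃ (C : Ctx F G) (σ : Sub F G), Satisfies σ ρ.cond ∧
    s = C.fill (ρ.lhs.subst σ) ∧ t = C.fill (ρ.rhs.subst σ)

/-- There is no infinite `r`-sequence that starts with `a`. -/
def TerminatingAt {α : Type} (r : α → α → Prop) (a : α) : Prop :=
  ¬ ∃ u : ℕ → α, u 0 = a ∧ ∀ n, r (u n) (u (n + 1))

/-- Termination of a constrained TRS: every term is terminating. -/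
def Terminating {F G : FirstOrder.Language.{0, 0}} [G.Structure ℤ] (R : Set (CRule F G)) : Prop :=
  ∀ t : Tm F G, TerminatingAt (Step R) t

/-! ### Dependency pairs and chains -/

/-- The set of defined symbols of `R`: root symbols of left-hand sides. -/
def IsDefined {F G : FirstOrder.Language.{0, 0}} (R : Set (CRule F G)) {n : ℕ} (f : (F.sum G).Functions n) :
    Prop :=
  ∃ ρ ∈ R, ∃ ts, ρ.lhs = Term.func f ts

/-- A marked term `f♯(t₁, …, tₙ)`; the mark occurs at the root only. -/
structure MTm (F G : FirstOrder.Language.{0, 0}) where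
  {arity : ℕ}
  symb : (F.sum G).Functions arity
  args : Fin arity → Tm F G

/-- The application of a substitution to a marked term. -/
def MTm.subst {F G : FirstOrder.Language.{0, 0}} (t : MTm F G) (σ : Sub F G) : MTm F G :=
  ⟨t.symb, fun i => (t.args i).subst σ⟩

/-- A marked term without variables. -/
def MTm.IsGround {F G : FirstOrder.Language.{0, 0}} (t : MTm F G) : Prop :=
  ∀ i, (t.args i).varFinset = ∅

/-- The rewrite relation of `R` on marked terms. Marked symbols do not occur in `R`, so all steps
are strictly below the root. -/
inductive MStep {F G : FirstOrder.Language.{0, 0}} [G.Structure ℤ] (R : Set (CRule F G)) :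
    MTm F G → MTm F G → Prop
  | below {n : ℕ} (f : (F.sum G).Functions n) (ts : Fin n → Tm F G) (i : Fin n) (t' : Tm F G) :
      Step R (ts i) t' → MStep R ⟨f, ts⟩ ⟨f, Function.update ts i t'⟩

/-- A triple `s♯ → t♯ [φ]`. -/
structure MPair (F G : FirstOrder.Language.{0, 0}) where
  lhs : MTm F G
  rhs : MTm F G
  cond : G.Formula ℕ

/-- The renamed variant of a pair along a bijective renaming of the variables. -/
def MPair.rename {F G : FirstOrder.Language.{0, 0}} (p : MPair F G) (π : Equiv.Perm ℕ) : MPair F G where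
  lhs := p.lhs.subst fun x => Term.var (π x)
  rhs := p.rhs.subst fun x => Term.var (π x)
  cond := p.cond.subst fun x => Term.var (π x)

/-- `DP(R)`: all `f♯(ss) → g♯(ts) [φ]` such that `f`, `g` are defined symbols and
`f(ss) → C[g(ts)] [φ]` is a renamed variant of a rule of `R`. -/
def DP {F G : FirstOrder.Language.{0, 0}} (R : Set (CRule F G)) : Set (MPair F G) :=
  {p | IsDefined R p.lhs.symb ∧ IsDefined R p.rhs.symb ∧
    ∃ ρ ∈ R, ∃ (π : Equiv.Perm ℕ) (C : Ctx F G),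
      ρ.rename π =
        ⟨Term.func p.lhs.symb p.lhs.args, C.fill (Term.func p.rhs.symb p.rhs.args), p.cond⟩}

/-- The pairs `p i` and substitutions `σ i`, `i < N`, form a (minimal) dependency chain
`s₀♯σ₀ → t₀♯σ₀ →* s₁♯σ₁ → t₁♯σ₁ →* …` with `N` steps of `S`; it is infinite if `N = ⊤`. -/
structure IsChain {F G : FirstOrder.Language.{0, 0}} [G.Structure ℤ] (S : Set (MPair F G))
    (R : Set (CRule F G)) (N : ℕ∞) (p : ℕ → MPair F G) (σ : ℕ → Sub F G) : Prop where
  mem : ∀ i : ℕ, (i : ℕ∞) < N → p i ∈ S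
  applicable : ∀ i : ℕ, (i : ℕ∞) < N → Satisfies (σ i) (p i).cond
  link : ∀ i : ℕ, ((i + 1 : ℕ) : ℕ∞) < N →
    Relation.ReflTransGen (MStep R) ((p i).rhs.subst (σ i)) ((p (i + 1)).lhs.subst (σ (i + 1)))
  minimal : ∀ i : ℕ, (i : ℕ∞) < N → TerminatingAt (MStep R) ((p i).rhs.subst (σ i))

/-- All terms of the chain are ground. -/
def IsGroundChain {F G : FirstOrder.Language.{0, 0}} [G.Structure ℤ] (S : Set (MPair F G))
    (R : Set (CRule F G)) (N : ℕ∞) (p : ℕ → MPair F G) (σ : ℕ → Sub F G) : Prop :=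
  IsChain S R N p σ ∧ ∀ i : ℕ, (i : ℕ∞) < N →
    ((p i).lhs.subst (σ i)).IsGround ∧ ((p i).rhs.subst (σ i)).IsGround

/-- The DP problem `(S, R)` is finite: it has no infinite chain. -/
def FiniteDP {F G : FirstOrder.Language.{0, 0}} [G.Structure ℤ] (S : Set (MPair F G)) (R : Set (CRule F G)) :
    Prop :=
  ¬ ∃ p σ, IsChain S R ⊤ p σ

/-- The edges of the dependency graph of `(S, R)`: `q` can directly follow `p` in a chain. -/
def DGEdge {F G : FirstOrder.Language.{0, 0}} [G.Structure ℤ] (S : Set (MPair F G)) (R : Set (CRule F G))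
    (p q : MPair F G) : Prop :=
  ∃ (c : ℕ → MPair F G) (σ : ℕ → Sub F G), c 0 = p ∧ c 1 = q ∧ IsChain S R 2 c σ

/-- The processor that decomposes `S` into the strongly connected components of the dependency
graph that contain a cycle. -/
def SCCProc {F G : FirstOrder.Language.{0, 0}} [G.Structure ℤ] (S : Set (MPair F G)) (R : Set (CRule F G)) :
    Set (Set (MPair F G)) :=
  {S' | ∃ p ∈ S, Relation.TransGen (DGEdge S R) p p ∧
    S' = {q ∈ S | Relation.TransGen (DGEdge S R) p q ∧ Relation.TransGen (DGEdge S R) q p}}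

/-! ### Linear polynomial interpretations -/

/-- The linear polynomial `const + coeff 0 * x₁ + … + coeff (n - 1) * xₙ`. -/
structure LinPoly (n : ℕ) where
  const : ℤ
  coeff : Fin n → ℤ

/-- The value of a linear polynomial. -/
def LinPoly.eval {n : ℕ} (P : LinPoly n) (v : Fin n → ℤ) : ℤ :=
  P.const + ∑ i, P.coeff i * v i

/-- A linear polynomial interpretation: `plain f` is `Pol(f)` for `f` in `F`, and `marked f` is
`Pol(f♯)` (its values at symbols that are not defined symbols play no role). -/
structure LinPI (F G : FirstOrder.Language.{0, 0}) where
  plain : ∀ {n : ℕ}, F.Functions n → LinPoly n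
  marked : ∀ {n : ℕ}, (F.sum G).Functions n → LinPoly n

/-- The value of `Pol(t)` when the variables take the values `v`; symbols of `G` keep their
meaning. -/
def LinPI.eval {F G : FirstOrder.Language.{0, 0}} [G.Structure ℤ] (Pol : LinPI F G) (v : ℕ → ℤ) : Tm F G → ℤ
  | .var x => v x
  | .func (Sum.inl f) ts => (Pol.plain f).eval fun i => Pol.eval v (ts i)
  | .func (Sum.inr g) ts => Structure.funMap g fun i => Pol.eval v (ts i)

/-- The value of `Pol(t♯)`. -/
def LinPI.meval {F G : FirstOrder.Language.{0, 0}} [G.Structure ℤ] (Pol : LinPI F G) (v : ℕ → ℤ)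
    (t : MTm F G) : ℤ :=
  (Pol.marked t.symb).eval fun i => Pol.eval v (t.args i)

/-- `φ ⇒ P` is valid, `P` being a condition on the values of the variables: it holds for the values
given by any ground substitution over `G`. -/
def ValidImp {G : FirstOrder.Language.{0, 0}} [G.Structure ℤ] (φ : G.Formula ℕ) (P : (ℕ → ℤ) → Prop) : Prop :=
  ∀ θ : ℕ → G.Term Empty, ℤ ⊨ (φ.subst θ : G.Sentence) → P fun x => (θ x).realize Empty.elim

/-- `i` is a reducible position of `f♯` w.r.t. `S`. -/
def IsReducible {F G : FirstOrder.Language.{0, 0}} (S : Set (MPair F G)) {n : ℕ} (f : (F.sum G).Functions n)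
    (i : Fin n) : Prop :=
  ∃ (l : MTm F G) (ts : Fin n → Tm F G) (φ : G.Formula ℕ),
    (⟨l, ⟨f, ts⟩, φ⟩ : MPair F G) ∈ S ∧ ¬ IsInterpreted (ts i) φ.freeVarFinset

/-- `v` is a term in which, below every subterm `t₁ - t₂`, the term `t₂` is in `T(G, W)`. A
subtraction symbol is a binary symbol of `G` whose interpretation is the subtraction of `ℤ`. -/
def SubtractionSafe {F G : FirstOrder.Language.{0, 0}} [G.Structure ℤ] (v : Tm F G) (W : Finset ℕ) : Prop :=
  ∀ g : G.Functions 2, (∀ x y : ℤ, Structure.funMap g ![x, y] = x - y) →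
    ∀ (C : Ctx F G) (ts : Fin 2 → Tm F G),
      v = C.fill (Term.func (Sum.inr g : (F.sum G).Functions 2) ts) → IsInterpreted (ts 1) W

/-- The conditions under which the processor for `(>, ≤, ≤)` can be applied to `(S, R)` with the
interpretation `Pol`. -/
structure Applicable {F G : FirstOrder.Language.{0, 0}} [G.Structure ℤ] (Pol : LinPI F G)
    (S : Set (MPair F G)) (R : Set (CRule F G)) : Prop where
  /-- No reduction of uninterpreted symbols below the second argument of a subtraction. -/
  sub_rules : ∀ ρ ∈ R, SubtractionSafe ρ.rhs ρ.cond.freeVarFinset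
  /-- The same for right-hand sides of pairs, below the root, which is a marked symbol. -/
  sub_pairs : ∀ p ∈ S, ∀ i, SubtractionSafe (p.rhs.args i) p.cond.freeVarFinset
  plain_nonneg : ∀ (n : ℕ) (f : F.Functions n) (i : Fin n), 0 ≤ (Pol.plain f).coeff i
  rules_le : ∀ ρ ∈ R, ValidImp ρ.cond fun v => Pol.eval v ρ.lhs ≤ Pol.eval v ρ.rhs
  reducible_nonpos : ∀ (n : ℕ) (f : (F.sum G).Functions n) (i : Fin n), IsReducible S f i →
    (Pol.marked f).coeff i ≤ 0
  pairs_ge : ∀ p ∈ S, ValidImp p.cond fun v => Pol.meval v p.lhs ≥ Pol.meval v p.rhs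

/-- `S_>`. -/
def strictPairs {F G : FirstOrder.Language.{0, 0}} [G.Structure ℤ] (Pol : LinPI F G) (S : Set (MPair F G)) :
    Set (MPair F G) :=
  {p ∈ S | ValidImp p.cond fun v => Pol.meval v p.lhs > Pol.meval v p.rhs}

/-- `S_bound`. -/
def boundedPairs {F G : FirstOrder.Language.{0, 0}} [G.Structure ℤ] (Pol : LinPI F G) (S : Set (MPair F G)) :
    Set (MPair F G) :=
  {p ∈ S | ∃ c : G.Term Empty, ValidImp p.cond fun v => Pol.meval v p.lhs ≥ c.realize Empty.elim}

/-- The set of DP problems that the processor for `(>, ≤, ≤)` returns. -/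
def PIProc {F G : FirstOrder.Language.{0, 0}} [G.Structure ℤ] (Pol : LinPI F G) (S : Set (MPair F G)) :
    Set (Set (MPair F G)) :=
  {S \ strictPairs Pol S, S \ boundedPairs Pol S}

/-! ### The system for the McCarthy 91 function -/

/-- The interpreted function symbols `0`, `s`, `p`. -/
inductive LIAFunc : ℕ → Type
  | zero : LIAFunc 0
  | succ : LIAFunc 1
  | pred : LIAFunc 1

/-- The predicate symbols `>` and `≥`; equality is built into first-order formulas. -/
inductive LIARel : ℕ → Type
  | gt : LIARel 2
  | ge : LIARel 2

/-- The interpreted signature with its predicate symbols. -/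
abbrev GLIA : FirstOrder.Language.{0, 0} := ⟨LIAFunc, LIARel⟩

/-- The meaning of the interpreted symbols over the integers. -/
instance : GLIA.Structure ℤ where
  funMap := fun {_} g =>
    match g with
    | LIAFunc.zero => fun _ => 0
    | LIAFunc.succ => fun v => v 0 + 1
    | LIAFunc.pred => fun v => v 0 - 1
  RelMap := fun {_} r =>
    match r with
    | LIARel.gt => fun v => v 0 > v 1
    | LIARel.ge => fun v => v 0 ≥ v 1

/-- The only uninterpreted symbol is `f`. -/
inductive McFunc : ℕ → Type
  | f : McFunc 1

/-- The uninterpreted signature. -/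
abbrev FMc : FirstOrder.Language.{0, 0} := ⟨McFunc, fun _ => Empty⟩

/-- `f` as a symbol of the whole signature. -/
def fSym : (FMc.sum GLIA).Functions 1 := Sum.inl McFunc.f

/-- `s` as a symbol of the whole signature. -/
def sSym : (FMc.sum GLIA).Functions 1 := Sum.inr LIAFunc.succ

/-- `p` as a symbol of the whole signature. -/
def pSym : (FMc.sum GLIA).Functions 1 := Sum.inr LIAFunc.pred

/-- The term `f(t)`. -/
def appF (t : Tm FMc GLIA) : Tm FMc GLIA := Term.func fSym fun _ => t

/-- The term `s(t)`. -/
def appS (t : Tm FMc GLIA) : Tm FMc GLIA := Term.func sSym fun _ => t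

/-- The term `p(t)`. -/
def appP (t : Tm FMc GLIA) : Tm FMc GLIA := Term.func pSym fun _ => t

/-- The variable `x`. -/
def varX : Tm FMc GLIA := Term.var 0

/-- The interpreted ground term `sⁿ(0)`. -/
def numeral (n : ℕ) : GLIA.Term ℕ :=
  (fun t => Term.func (L := GLIA) LIAFunc.succ fun _ => t)^[n]
    (Term.func (L := GLIA) LIAFunc.zero Fin.elim0)

/-- The constraint `s¹⁰¹(0) > x`. -/
def below101 : GLIA.Formula ℕ :=
  Relations.formula₂ (L := GLIA) LIARel.gt (numeral 101) (Term.var 0)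

/-- The constrained TRS `R₁`. -/
def mcCarthy : Set (CRule FMc GLIA) :=
  {⟨appF varX, appF (appF (appS^[11] varX)), below101⟩,
   ⟨appF varX, appP^[10] varX, below101.not⟩,
   ⟨appS (appP varX), varX, ⊤⟩,
   ⟨appP (appS varX), varX, ⊤⟩}

/-- `R₁` is a finite set of constrained rewrite rules. -/
theorem mcCarthy_wellFormed : mcCarthy.Finite ∧ ∀ ρ ∈ mcCarthy, ρ.WellFormed := by
  have hq : below101.IsQF :=
    (BoundedFormula.IsAtomic.rel (L := GLIA) (LIARel.gt : GLIA.Relations 2) _).isQF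
  have hn (t : GLIA.Term ℕ) (n : ℕ) :
      ((fun t => Term.func (L := GLIA) (LIAFunc.succ : GLIA.Functions 1) fun _ => t)^[n]
        t).varFinset = t.varFinset := by
    induction n generalizing t with
    | zero => rfl
    | succ n ih =>
      rw [Function.iterate_succ_apply, ih]
      simp [Term.varFinset]
  have hl (t : GLIA.Term ℕ) :
      (t.relabel (Sum.inl : ℕ → ℕ ⊕ Fin 0)).varFinsetLeft = t.varFinset := by
    induction t with
    | var => rfl
    | func g ts ih => simp [Term.relabel, Term.varFinsetLeft, Term.varFinset, ih]
  have hg (t u : GLIA.Term ℕ) :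
      (Relations.formula₂ (L := GLIA) LIARel.gt t u).freeVarFinset ⊆
        t.varFinset ∪ u.varFinset := by
    intro y hy
    obtain ⟨i, -, hi⟩ := Finset.mem_biUnion.1 hy
    fin_cases i
    · have h0 : y ∈ (t.relabel (Sum.inl : ℕ → ℕ ⊕ Fin 0)).varFinsetLeft := hi
      exact Finset.mem_union_left _ (hl t ▸ h0)
    · have h0 : y ∈ (u.relabel (Sum.inl : ℕ → ℕ ⊕ Fin 0)).varFinsetLeft := hi
      exact Finset.mem_union_right _ (hl u ▸ h0)
  have h101 : (numeral 101).varFinset = ∅ := by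
    rw [numeral, hn]
    simp [Term.varFinset]
  have hb : below101.freeVarFinset ⊆ {0} := by
    refine (hg _ _).trans ?_
    rw [h101, Finset.empty_union]
    exact subset_rfl
  have hx : varX.varFinset = {0} := rfl
  have hf (t : Tm FMc GLIA) : (appF t).varFinset = t.varFinset := by
    simp [appF, Term.varFinset]
  have hs (t : Tm FMc GLIA) (n : ℕ) : (appS^[n] t).varFinset = t.varFinset := by
    induction n generalizing t with
    | zero => rfl
    | succ n ih => rw [Function.iterate_succ_apply, ih]; simp [appS, Term.varFinset]
  have hp (t : Tm FMc GLIA) (n : ℕ) : (appP^[n] t).varFinset = t.varFinset := by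
    induction n generalizing t with
    | zero => rfl
    | succ n ih => rw [Function.iterate_succ_apply, ih]; simp [appP, Term.varFinset]
  have hs1 (t : Tm FMc GLIA) : (appS t).varFinset = t.varFinset := hs t 1
  have hp1 (t : Tm FMc GLIA) : (appP t).varFinset = t.varFinset := hp t 1
  have ht : (⊤ : GLIA.Formula ℕ).freeVarFinset = ∅ := rfl
  have hbn : below101.not.freeVarFinset ⊆ {0} := by
    change below101.freeVarFinset ∪ ∅ ⊆ {0}
    rwa [Finset.union_empty]
  refine ⟨by simp [mcCarthy], ?_⟩
  intro ρ hρ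
  simp only [mcCarthy, Set.mem_insert_iff, Set.mem_singleton_iff] at hρ
  rcases hρ with rfl | rfl | rfl | rfl
  · refine ⟨fun y h => by simp [appF] at h, hq, ?_, ?_⟩
    · simp only [hf, hs, subset_refl]
    · simp only [hf, hx]
      exact hb
  · refine ⟨fun y h => by simp [appF] at h, hq.not, ?_, ?_⟩
    · simp only [hf, hp, subset_refl]
    · simp only [hf, hx]
      exact hbn
  · exact ⟨fun y h => by simp [appS] at h, BoundedFormula.isQF_bot.not, by rw [hs1, hp1],
      by rw [ht]; exact Finset.empty_subset _⟩
  · exact ⟨fun y h => by simp [appP] at h, BoundedFormula.isQF_bot.not, by rw [hp1, hs1],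
      by rw [ht]; exact Finset.empty_subset _⟩

/-- The pair (3): `f♯(x) → f♯(f(s¹¹(x))) [s¹⁰¹(0) > x]`. -/
def pair3 : MPair FMc GLIA :=
  ⟨⟨fSym, fun _ => varX⟩, ⟨fSym, fun _ => appF (appS^[11] varX)⟩, below101⟩

/-- The pair (4): `f♯(x) → f♯(s¹¹(x)) [s¹⁰¹(0) > x]`. -/
def pair4 : MPair FMc GLIA :=
  ⟨⟨fSym, fun _ => varX⟩, ⟨fSym, fun _ => appS^[11] varX⟩, below101⟩

/-- The pairs (5): `f♯(x) → s♯(sⁱ(x)) [s¹⁰¹(0) > x]`. -/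
def pair5 (i : ℕ) : MPair FMc GLIA :=
  ⟨⟨fSym, fun _ => varX⟩, ⟨sSym, fun _ => appS^[i] varX⟩, below101⟩

/-- The pairs (6): `f♯(x) → p♯(pⁱ(x)) [¬ (s¹⁰¹(0) > x)]`. -/
def pair6 (i : ℕ) : MPair FMc GLIA :=
  ⟨⟨fSym, fun _ => varX⟩, ⟨pSym, fun _ => appP^[i] varX⟩, below101.not⟩

/-- The list (3)–(6) of the dependency pairs of `R₁`, one for each class of renamed variants. -/
def mcCarthyDP : Set (MPair FMc GLIA) :=
  {pair3, pair4} ∪ {q | ∃ i ≤ 10, q = pair5 i} ∪ {q | ∃ i ≤ 9, q = pair6 i}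

end CTRS

/-!
Every term is a word over `f`, `s`, `p` that ends in a variable or in `0`, and every rule is correct
over `ℤ` once `f` is read as the McCarthy function `mc91`. So each term has a value that rewriting
keeps, and each call `f(t)` can be given a weight `callCost` that depends on the value of `t` only.
The weight `11 + 23 * max 0 (101 - n)` exceeds the total weight of the two nested calls that replace
`f(n)` together with the number of symbols `s` and `p` that are created (`callCost_unfold`). Adding
up these weights and the number of interpreted symbols gives `cost`, a natural number that drops in
every rewrite step (`cost_lt_of_step`), on nonground terms as well: a constraint that is valid after
instantiation holds for all values of the remaining variables. The pairs `pair3` and `pair4`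
lower the cost too (`cost_pair_lt`). This proves both termination and the absence of infinite chains.

The dependency pairs are found by listing the subterms of the right-hand sides. In the dependency
graph, no pair can follow one with the right-hand side root `s♯` or `p♯`, because rewriting keeps the
root and every left-hand side has the root `f♯`; all four edges between `pair3` and `pair4`
are exhibited by explicit chains (`DGEdge_of_mem`).

For the interpretation of `f` by `n - 10`, values do not decrease in rewrite steps
(`evalWith_le_of_step`), and `f♯` reverses the order; each pair raises the argument by at least `1`
(`LinPI.meval_pair`), while its constraint keeps the argument below `101`, hence the bound `-101`.
-/

namespace CTRS

open FirstOrder FirstOrder.Language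

/-! ### Unary terms and contexts -/

theorem subst_appF (t : Tm FMc GLIA) (σ : Sub FMc GLIA) :
    (appF t).subst σ = appF (t.subst σ) := rfl

theorem subst_appS (t : Tm FMc GLIA) (σ : Sub FMc GLIA) :
    (appS t).subst σ = appS (t.subst σ) := rfl

theorem subst_appP (t : Tm FMc GLIA) (σ : Sub FMc GLIA) :
    (appP t).subst σ = appP (t.subst σ) := rfl

theorem subst_varX (σ : Sub FMc GLIA) : varX.subst σ = σ 0 := rfl

theorem subst_iterate_appS (n : ℕ) (t : Tm FMc GLIA) (σ : Sub FMc GLIA) :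
    (appS^[n] t).subst σ = appS^[n] (t.subst σ) := by
  induction n generalizing t with
  | zero => rfl
  | succ n ih => rw [Function.iterate_succ_apply, ih, subst_appS, ← Function.iterate_succ_apply]

theorem subst_iterate_appP (n : ℕ) (t : Tm FMc GLIA) (σ : Sub FMc GLIA) :
    (appP^[n] t).subst σ = appP^[n] (t.subst σ) := by
  induction n generalizing t with
  | zero => rfl
  | succ n ih => rw [Function.iterate_succ_apply, ih, subst_appP, ← Function.iterate_succ_apply]

theorem update_fin_one {α : Type*} (us : Fin 1 → α) (j : Fin 1) (a : α) :
    Function.update us j a = fun _ => a := by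
  funext k
  rw [Subsingleton.elim k j, Function.update_self]

/-- The only symbols with arguments are `f`, `s` and `p`, so a nonempty context is one of them
applied to a context. -/
theorem Ctx.fill_arg_cases {n : ℕ} (g : (FMc.sum GLIA).Functions n) (i : Fin n)
    (ts : Fin n → Tm FMc GLIA) (C : Ctx FMc GLIA) :
    (∀ t, (Ctx.arg g i ts C).fill t = appF (C.fill t)) ∨
    (∀ t, (Ctx.arg g i ts C).fill t = appS (C.fill t)) ∨
    (∀ t, (Ctx.arg g i ts C).fill t = appP (C.fill t)) := by
  rcases g with g | g
  · cases g
    exact Or.inl fun t => congrArg (Term.func _) (update_fin_one _ _ _)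
  · cases g
    · exact i.elim0
    · exact Or.inr (Or.inl fun t => congrArg (Term.func _) (update_fin_one _ _ _))
    · exact Or.inr (Or.inr fun t => congrArg (Term.func _) (update_fin_one _ _ _))

/-- `u` is a subterm of `t`. -/
def IsSubterm {F G : FirstOrder.Language.{0, 0}} (u t : Tm F G) : Prop :=
  ∃ C : Ctx F G, C.fill u = t

theorem isSubterm_var {F G : FirstOrder.Language.{0, 0}} {u : Tm F G} {x : ℕ} :
    IsSubterm u (Term.var x) ↔ u = Term.var x := by
  constructor
  · rintro ⟨C, hC⟩
    cases C with
    | hole => exact hC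
    | arg g i ts C => cases hC
  · rintro rfl
    exact ⟨.hole, rfl⟩

theorem isSubterm_unary {F G : FirstOrder.Language.{0, 0}} {u t : Tm F G}
    {g : (F.sum G).Functions 1} :
    IsSubterm u (Term.func g fun _ => t) ↔ u = Term.func g (fun _ => t) ∨ IsSubterm u t := by
  constructor
  · rintro ⟨C, hC⟩
    cases C with
    | hole => exact Or.inl hC
    | arg h i ts C =>
      right
      rw [Ctx.fill] at hC
      injection hC with h1 h2 h3
      subst h1
      have := congrFun (eq_of_heq h3) i
      rw [Function.update_self] at this
      exact ⟨C, this⟩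
  · rintro (rfl | ⟨C, rfl⟩)
    · exact ⟨.hole, rfl⟩
    · refine ⟨.arg g 0 (fun _ => C.fill u) C, ?_⟩
      rw [Ctx.fill]
      congr 1
      exact Function.update_eq_self _ _

theorem isSubterm_iterate {F G : FirstOrder.Language.{0, 0}} {u : Tm F G} {x : ℕ}
    (g : (F.sum G).Functions 1) (n : ℕ) :
    IsSubterm u ((fun t => Term.func g fun _ => t)^[n] (Term.var x)) ↔
      u = Term.var x ∨
        ∃ i < n, u = Term.func g fun _ => (fun t => Term.func g fun _ => t)^[i] (Term.var x) := by
  induction n with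
  | zero => simpa using isSubterm_var
  | succ n ih =>
    rw [Function.iterate_succ_apply', isSubterm_unary, ih]
    constructor
    · rintro (h | h | ⟨i, hi, h⟩)
      · exact Or.inr ⟨n, n.lt_succ_self, h⟩
      · exact Or.inl h
      · exact Or.inr ⟨i, by omega, h⟩
    · rintro (h | ⟨i, hi, h⟩)
      · exact Or.inr (Or.inl h)
      · rcases Nat.lt_succ_iff_lt_or_eq.1 hi with hi | rfl
        · exact Or.inr (Or.inr ⟨i, hi, h⟩)
        · exact Or.inl h

/-- The term `f(t₁, …, tₙ)` obtained from `f♯(t₁, …, tₙ)` by removing the mark. -/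
def MTm.unmark {F G : FirstOrder.Language.{0, 0}} (t : MTm F G) : Tm F G :=
  Term.func t.symb t.args

theorem MTm.unmark_injective {F G : FirstOrder.Language.{0, 0}} :
    Function.Injective (MTm.unmark : MTm F G → Tm F G) := by
  rintro ⟨f, ts⟩ ⟨g, us⟩ h
  cases h
  rfl

/-- Removing the mark turns steps on marked terms into ordinary steps. -/
theorem MStep.unmark {F G : FirstOrder.Language.{0, 0}} [G.Structure ℤ] {R : Set (CRule F G)}
    {a b : MTm F G} (h : MStep R a b) : Step R a.unmark b.unmark := by
  obtain ⟨f, ts, i, t', ρ, hρ, C, σ, hσ, h1, h2⟩ := h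
  refine ⟨ρ, hρ, .arg f i ts C, σ, hσ, ?_, ?_⟩
  · rw [Ctx.fill, ← h1, Function.update_eq_self]
    rfl
  · rw [Ctx.fill, ← h2]
    rfl

/-! ### Values of terms and constraints -/

/-- The value of a term when the variables take the values `v` and `f` is interpreted by `h`. It is
used with `mc91` for `h` in the termination proof and with `n ↦ n - 10` for `Pol`. -/
def evalWith (h : ℤ → ℤ) (v : ℕ → ℤ) : Tm FMc GLIA → ℤ
  | .var x => v x
  | .func (Sum.inl McFunc.f) ts => h (evalWith h v (ts 0))
  | .func (Sum.inr g) ts => Structure.funMap g fun i => evalWith h v (ts i)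

section evalWith
variable (h : ℤ → ℤ) (v : ℕ → ℤ)

theorem evalWith_appF (t : Tm FMc GLIA) : evalWith h v (appF t) = h (evalWith h v t) := rfl

theorem evalWith_appS (t : Tm FMc GLIA) : evalWith h v (appS t) = evalWith h v t + 1 := rfl

theorem evalWith_appP (t : Tm FMc GLIA) : evalWith h v (appP t) = evalWith h v t - 1 := rfl

theorem evalWith_iterate_appS (n : ℕ) (t : Tm FMc GLIA) :
    evalWith h v (appS^[n] t) = evalWith h v t + n := by
  induction n with
  | zero => simp
  | succ n ih =>
    rw [Function.iterate_succ_apply', evalWith_appS, ih]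
    push_cast
    ring

theorem evalWith_iterate_appP (n : ℕ) (t : Tm FMc GLIA) :
    evalWith h v (appP^[n] t) = evalWith h v t - n := by
  induction n with
  | zero => simp
  | succ n ih =>
    rw [Function.iterate_succ_apply', evalWith_appP, ih]
    push_cast
    ring

theorem evalWith_embed (t : GLIA.Term ℕ) : evalWith h v (embed t) = t.realize v := by
  induction t with
  | var x => rfl
  | func g ts ih =>
    have e : evalWith h v (embed (Term.func g ts)) =
        Structure.funMap g fun i => evalWith h v (embed (ts i)) := by
      rw [embed, LHom.onTerm]
      exact evalWith.eq_3 h v _ g _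
    rw [e, funext ih]
    rfl

end evalWith

/-- Every integer is the value of a ground term over `0`, `s`, `p`. -/
theorem exists_ground_realize (n : ℤ) : ∃ t : GLIA.Term Empty, t.realize Empty.elim = n := by
  induction n using Int.induction_on with
  | zero => exact ⟨Term.func (L := GLIA) LIAFunc.zero Fin.elim0, rfl⟩
  | succ n ih =>
    obtain ⟨t, ht⟩ := ih
    exact ⟨Term.func (L := GLIA) LIAFunc.succ fun _ => t, congrArg (· + 1) ht⟩
  | pred n ih =>
    obtain ⟨t, ht⟩ := ih
    exact ⟨Term.func (L := GLIA) LIAFunc.pred fun _ => t, congrArg (· - 1) ht⟩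

theorem models_subst {G : FirstOrder.Language.{0, 0}} [G.Structure ℤ] (φ : G.Formula ℕ)
    (θ : ℕ → G.Term Empty) :
    ℤ ⊨ (φ.subst θ : G.Sentence) ↔ φ.Realize (M := ℤ) fun x => (θ x).realize Empty.elim := by
  rw [Sentence.Realize, Formula.Realize, BoundedFormula.realize_subst, Formula.Realize]
  exact iff_of_eq (congrArg₂ (fun (w : Empty → ℤ) (z : Fin 0 → ℤ) =>
    BoundedFormula.Realize φ (fun x => (θ x).realize w) z)
    (Subsingleton.elim _ _) (Subsingleton.elim _ _))

theorem validImp_iff (φ : GLIA.Formula ℕ) (P : (ℕ → ℤ) → Prop) :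
    ValidImp φ P ↔ ∀ v : ℕ → ℤ, φ.Realize v → P v := by
  constructor
  · intro H v hv
    choose θ hθ using fun x => exists_ground_realize (v x)
    have := H θ
    rw [models_subst, funext hθ] at this
    exact this hv
  · intro H θ hθ
    exact H _ ((models_subst _ _).1 hθ)

theorem valid_iff (φ : GLIA.Formula ℕ) : Valid φ ↔ ∀ v : ℕ → ℤ, φ.Realize v := by
  constructor
  · intro H v
    choose θ hθ using fun x => exists_ground_realize (v x)
    have := H θ
    rwa [models_subst, funext hθ] at this
  · intro H θ
    exact (models_subst _ _).2 (H _)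

/-- An instance of a constraint with variables left is valid only if the constraint holds for all
values of these variables. -/
theorem valid_subst_iff (φ : GLIA.Formula ℕ) (τ : ℕ → GLIA.Term ℕ) :
    Valid (φ.subst τ) ↔ ∀ v : ℕ → ℤ, φ.Realize fun x => (τ x).realize v := by
  rw [valid_iff]
  refine forall_congr' fun v => ?_
  rw [Formula.Realize, BoundedFormula.realize_subst, Formula.Realize]

theorem realize_numeral (n : ℕ) (v : ℕ → ℤ) : (numeral n).realize v = n := by
  induction n with
  | zero => rfl
  | succ n ih =>
    rw [numeral, Function.iterate_succ_apply', ← numeral]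
    push_cast
    rw [← ih]
    rfl

theorem realize_below101 (v : ℕ → ℤ) : below101.Realize v ↔ v 0 < 101 := by
  have h : below101.Realize v ↔ v 0 < (numeral 101).realize v := by
    rw [below101, Formula.realize_rel₂]
    rfl
  rw [h, realize_numeral]
  rfl

theorem mem_freeVarFinset_gt_var (t : GLIA.Term ℕ) (x : ℕ) :
    x ∈ (Relations.formula₂ (L := GLIA) LIARel.gt t (Term.var x)).freeVarFinset :=
  Finset.mem_biUnion.2 ⟨1, Finset.mem_univ _, Finset.mem_singleton_self _⟩

-- The depth limit is raised where unification unfolds the `101` nested symbols of `numeral 101`.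
set_option maxRecDepth 4000 in
theorem mem_freeVarFinset_below101 : 0 ∈ below101.freeVarFinset :=
  mem_freeVarFinset_gt_var (numeral 101) 0

set_option maxRecDepth 4000 in
/-- The condition on `σ` forces `σ 0` to be an interpreted term, so the bound holds however `f` is
interpreted. -/
theorem Satisfies.lt {σ : Sub FMc GLIA} (H : Satisfies σ below101) (h : ℤ → ℤ) (v : ℕ → ℤ) :
    evalWith h v (σ 0) < 101 := by
  obtain ⟨τ, hτ, hv⟩ := H
  rw [hτ 0 mem_freeVarFinset_below101, evalWith_embed]
  exact (realize_below101 _).1 ((valid_subst_iff _ _).1 hv v)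

set_option maxRecDepth 4000 in
theorem Satisfies.ge {σ : Sub FMc GLIA} (H : Satisfies σ below101.not) (h : ℤ → ℤ) (v : ℕ → ℤ) :
    101 ≤ evalWith h v (σ 0) := by
  obtain ⟨τ, hτ, hv⟩ := H
  rw [hτ 0 (Finset.mem_union_left _ mem_freeVarFinset_below101), evalWith_embed]
  have := (valid_subst_iff _ _).1 hv v
  rw [Formula.realize_not, realize_below101] at this
  exact not_lt.1 this

/-! ### Termination -/

/-- The McCarthy 91 function. -/
def mc91 (n : ℤ) : ℤ := if n < 101 then 91 else n - 10

/-- The weight of a call `f(n)`. It satisfies `callCost n > 11 + callCost (n + 11) + callCost m` with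
`m = mc91 (n + 11)` for `n < 101`, and `callCost n > 10` otherwise; the summands `11` and `10` pay
for the symbols `s` and `p` that the two rules for `f` create. For `90 ≤ n < 101` the first
inequality reads `callCost n > 22 + callCost (n + 1)`, whence the slope `23`. -/
def callCost (n : ℤ) : ℕ := 11 + 23 * (101 - n).toNat

/-- The number of symbols `s`, `p` (and `0`) in a term plus the weights of all its calls of `f`,
each taken at the actual value of its argument. -/
def cost (v : ℕ → ℤ) : Tm FMc GLIA → ℕ
  | .var _ => 0
  | .func (Sum.inl McFunc.f) ts => cost v (ts 0) + callCost (evalWith mc91 v (ts 0))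
  | .func (Sum.inr _) ts => 1 + ∑ i, cost v (ts i)

theorem cost_appF (v : ℕ → ℤ) (t : Tm FMc GLIA) :
    cost v (appF t) = cost v t + callCost (evalWith mc91 v t) := rfl

theorem cost_appS (v : ℕ → ℤ) (t : Tm FMc GLIA) : cost v (appS t) = 1 + cost v t := by
  rw [appS, sSym, cost.eq_3]
  simp

theorem cost_appP (v : ℕ → ℤ) (t : Tm FMc GLIA) : cost v (appP t) = 1 + cost v t := by
  rw [appP, pSym, cost.eq_3]
  simp

theorem cost_iterate_appS (v : ℕ → ℤ) (n : ℕ) (t : Tm FMc GLIA) :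
    cost v (appS^[n] t) = n + cost v t := by
  induction n with
  | zero => simp
  | succ n ih => rw [Function.iterate_succ_apply', cost_appS, ih]; ring

theorem cost_iterate_appP (v : ℕ → ℤ) (n : ℕ) (t : Tm FMc GLIA) :
    cost v (appP^[n] t) = n + cost v t := by
  induction n with
  | zero => simp
  | succ n ih => rw [Function.iterate_succ_apply', cost_appP, ih]; ring

theorem callCost_unfold {n : ℤ} (hn : n < 101) :
    11 + callCost (n + 11) + callCost (mc91 (n + 11)) < callCost n := by
  unfold callCost mc91
  split_ifs <;> omega

theorem mc91_unfold {n : ℤ} (hn : n < 101) : mc91 (mc91 (n + 11)) = mc91 n := by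
  unfold mc91
  split_ifs <;> omega

/-- A decrease of the cost that keeps the value passes to contexts. -/
theorem cost_fill {v : ℕ → ℤ} {s t : Tm FMc GLIA} (C : Ctx FMc GLIA)
    (he : evalWith mc91 v s = evalWith mc91 v t) (hc : cost v t < cost v s) :
    evalWith mc91 v (C.fill s) = evalWith mc91 v (C.fill t) ∧
      cost v (C.fill t) < cost v (C.fill s) := by
  induction C with
  | hole => exact ⟨he, hc⟩
  | arg g i ts C ih =>
    obtain ⟨ih1, ih2⟩ := ih
    rcases Ctx.fill_arg_cases g i ts C with h | h | h
    · simp only [h, evalWith_appF, cost_appF, ih1]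
      exact ⟨trivial, by omega⟩
    · simp only [h, evalWith_appS, cost_appS, ih1]
      exact ⟨trivial, by omega⟩
    · simp only [h, evalWith_appP, cost_appP, ih1]
      exact ⟨trivial, by omega⟩

theorem cost_lt_of_step (v : ℕ → ℤ) {s t : Tm FMc GLIA} (h : Step mcCarthy s t) :
    cost v t < cost v s := by
  obtain ⟨ρ, hρ, C, σ, hσ, rfl, rfl⟩ := h
  suffices H : evalWith mc91 v (ρ.lhs.subst σ) = evalWith mc91 v (ρ.rhs.subst σ) ∧
      cost v (ρ.rhs.subst σ) < cost v (ρ.lhs.subst σ) from (cost_fill C H.1 H.2).2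
  simp only [mcCarthy, Set.mem_insert_iff, Set.mem_singleton_iff] at hρ
  rcases hρ with rfl | rfl | rfl | rfl
  · have hlt := hσ.lt mc91 v
    have := callCost_unfold hlt
    simp only [subst_appF, subst_iterate_appS, subst_varX, evalWith_appF, evalWith_iterate_appS,
      cost_appF, cost_iterate_appS, Nat.cast_ofNat]
    exact ⟨(mc91_unfold hlt).symm, by omega⟩
  · have hge := hσ.ge mc91 v
    simp only [subst_appF, subst_iterate_appP, subst_varX, evalWith_appF, evalWith_iterate_appP,
      cost_appF, cost_iterate_appP, Nat.cast_ofNat, mc91, callCost]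
    split_ifs <;> omega
  · simp only [subst_appS, subst_appP, subst_varX, evalWith_appS, evalWith_appP, cost_appS,
      cost_appP]
    omega
  · simp only [subst_appS, subst_appP, subst_varX, evalWith_appS, evalWith_appP, cost_appS,
      cost_appP]
    omega

theorem terminatingAt_of_measure {α : Type} {r : α → α → Prop} (m : α → ℕ)
    (hm : ∀ a b, r a b → m b < m a) (a : α) : TerminatingAt r a := by
  rintro ⟨u, -, hu⟩
  exact RelEmbedding.not_wellFounded
    (RelEmbedding.natGT (r := (· < ·)) (fun n => m (u n)) fun n => hm _ _ (hu n)) wellFounded_lt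

theorem terminating_mcCarthy : Terminating mcCarthy := fun t =>
  terminatingAt_of_measure (cost 0) (fun _ _ => cost_lt_of_step 0) t

theorem terminatingAt_mstep (t : MTm FMc GLIA) : TerminatingAt (MStep mcCarthy) t :=
  terminatingAt_of_measure (fun t => cost 0 t.unmark) (fun _ _ h => cost_lt_of_step 0 h.unmark) t

theorem cost_le_of_reflTransGen (v : ℕ → ℤ) {a b : MTm FMc GLIA}
    (h : Relation.ReflTransGen (MStep mcCarthy) a b) : cost v b.unmark ≤ cost v a.unmark := by
  induction h with
  | refl => exact le_rfl
  | tail _ h ih => exact (cost_lt_of_step v h.unmark).le.trans ih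

theorem cost_pair_lt (v : ℕ → ℤ) {q : MPair FMc GLIA} (hq : q ∈ ({pair3, pair4} : Set _))
    {σ : Sub FMc GLIA} (hσ : Satisfies σ q.cond) :
    cost v (q.rhs.subst σ).unmark < cost v (q.lhs.subst σ).unmark := by
  rcases hq with rfl | rfl
  · have := callCost_unfold (hσ.lt mc91 v)
    change cost v (appF ((appF (appS^[11] varX)).subst σ)) < cost v (appF (varX.subst σ))
    simp only [subst_appF, subst_iterate_appS, subst_varX, evalWith_appF, evalWith_iterate_appS,
      cost_appF, cost_iterate_appS, Nat.cast_ofNat]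
    omega
  · have := callCost_unfold (hσ.lt mc91 v)
    change cost v (appF ((appS^[11] varX).subst σ)) < cost v (appF (varX.subst σ))
    simp only [subst_iterate_appS, subst_varX, evalWith_iterate_appS,
      cost_appF, cost_iterate_appS, Nat.cast_ofNat]
    omega

theorem finiteDP_pairs : FiniteDP {pair3, pair4} mcCarthy := by
  rintro ⟨p, σ, h⟩
  refine terminatingAt_of_measure (r := fun a b : ℕ => b < a) id (fun _ _ h => h) _
    ⟨fun i => cost 0 ((p i).lhs.subst (σ i)).unmark, rfl, fun i => ?_⟩
  exact (cost_le_of_reflTransGen 0 (h.link i (ENat.natCast_lt_top _))).trans_lt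
    (cost_pair_lt 0 (h.mem i (ENat.natCast_lt_top _)) (h.applicable i (ENat.natCast_lt_top _)))

/-! ### Dependency pairs -/

theorem isSubterm_appF {u t : Tm FMc GLIA} :
    IsSubterm u (appF t) ↔ u = appF t ∨ IsSubterm u t := isSubterm_unary

theorem isSubterm_iterate_appS {u : Tm FMc GLIA} {x n : ℕ} :
    IsSubterm u (appS^[n] (Term.var x)) ↔
      u = Term.var x ∨ ∃ i < n, u = appS (appS^[i] (Term.var x)) := isSubterm_iterate sSym n

theorem isSubterm_iterate_appP {u : Tm FMc GLIA} {x n : ℕ} :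
    IsSubterm u (appP^[n] (Term.var x)) ↔
      u = Term.var x ∨ ∃ i < n, u = appP (appP^[i] (Term.var x)) := isSubterm_iterate pSym n

theorem isDefined_fSym : IsDefined mcCarthy fSym := ⟨_, Or.inl rfl, _, rfl⟩

theorem isDefined_sSym : IsDefined mcCarthy sSym := ⟨_, Or.inr (Or.inr (Or.inl rfl)), _, rfl⟩

theorem isDefined_pSym : IsDefined mcCarthy pSym := ⟨_, Or.inr (Or.inr (Or.inr rfl)), _, rfl⟩

/-- Dependency pairs in terms of subterms of the right-hand sides of renamed rules. -/
theorem mem_DP_iff {F G : FirstOrder.Language.{0, 0}} {R : Set (CRule F G)} {q : MPair F G} :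
    q ∈ DP R ↔ IsDefined R q.lhs.symb ∧ IsDefined R q.rhs.symb ∧
      ∃ ρ ∈ R, ∃ π : Equiv.Perm ℕ, q.lhs.unmark = (ρ.rename π).lhs ∧
        IsSubterm q.rhs.unmark (ρ.rename π).rhs ∧ q.cond = (ρ.rename π).cond := by
  refine and_congr_right fun _ => and_congr_right fun _ => exists_congr fun ρ =>
    and_congr_right fun _ => exists_congr fun π => ?_
  constructor
  · rintro ⟨C, h⟩
    rw [h]
    exact ⟨rfl, ⟨C, rfl⟩, rfl⟩
  · rintro ⟨h1, ⟨C, h2⟩, h3⟩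
    refine ⟨C, ?_⟩
    change _ = CRule.mk q.lhs.unmark (C.fill q.rhs.unmark) q.cond
    rw [h1, h2, h3]

theorem eq_of_unmark_eq_unary {F G : FirstOrder.Language.{0, 0}} {m : MTm F G}
    {g : (F.sum G).Functions 1} {t : Tm F G} (h : m.unmark = Term.func g fun _ => t) :
    m = ⟨g, fun _ => t⟩ := MTm.unmark_injective h

theorem MTm.unmark_ne_var {F G : FirstOrder.Language.{0, 0}} (m : MTm F G) (x : ℕ) :
    m.unmark ≠ Term.var x := nofun

theorem rename_pair3 (π : Equiv.Perm ℕ) : pair3.rename π =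
    ⟨⟨fSym, fun _ => Term.var (π 0)⟩, ⟨fSym, fun _ => appF (appS^[11] (Term.var (π 0)))⟩,
      below101.subst fun x => Term.var (π x)⟩ := rfl

theorem rename_pair4 (π : Equiv.Perm ℕ) : pair4.rename π =
    ⟨⟨fSym, fun _ => Term.var (π 0)⟩, ⟨fSym, fun _ => appS^[11] (Term.var (π 0))⟩,
      below101.subst fun x => Term.var (π x)⟩ := rfl

theorem rename_pair5 (i : ℕ) (π : Equiv.Perm ℕ) : (pair5 i).rename π =
    ⟨⟨fSym, fun _ => Term.var (π 0)⟩, ⟨sSym, fun _ => appS^[i] (Term.var (π 0))⟩,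
      below101.subst fun x => Term.var (π x)⟩ := by
  simp only [MPair.rename, MTm.subst, pair5, subst_iterate_appS, subst_varX]

theorem rename_pair6 (i : ℕ) (π : Equiv.Perm ℕ) : (pair6 i).rename π =
    ⟨⟨fSym, fun _ => Term.var (π 0)⟩, ⟨pSym, fun _ => appP^[i] (Term.var (π 0))⟩,
      below101.not.subst fun x => Term.var (π x)⟩ := by
  simp only [MPair.rename, MTm.subst, pair6, subst_iterate_appP, subst_varX]

theorem DP_mcCarthy :
    DP mcCarthy = {q | ∃ p ∈ mcCarthyDP, ∃ π : Equiv.Perm ℕ, q = p.rename π} := by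
  ext q
  rw [mem_DP_iff]
  constructor
  · rintro ⟨-, -, ρ, hρ, π, h1, h2, h3⟩
    obtain ⟨l, r, φ⟩ := q
    simp only [mcCarthy, Set.mem_insert_iff, Set.mem_singleton_iff] at hρ
    rcases hρ with rfl | rfl | rfl | rfl
    · simp only [CRule.rename, subst_appF, subst_iterate_appS, subst_varX, isSubterm_appF,
        isSubterm_iterate_appS] at h1 h2 h3
      obtain rfl := eq_of_unmark_eq_unary h1
      subst h3
      rcases h2 with h2 | h2 | h2 | ⟨i, hi, h2⟩
      · obtain rfl := eq_of_unmark_eq_unary h2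
        exact ⟨pair3, by simp [mcCarthyDP], π, (rename_pair3 π).symm⟩
      · obtain rfl := eq_of_unmark_eq_unary h2
        exact ⟨pair4, by simp [mcCarthyDP], π, (rename_pair4 π).symm⟩
      · exact absurd h2 (MTm.unmark_ne_var _ _)
      · obtain rfl := eq_of_unmark_eq_unary h2
        exact ⟨pair5 i, Or.inl (Or.inr ⟨i, by omega, rfl⟩), π, (rename_pair5 i π).symm⟩
    · simp only [CRule.rename, subst_appF, subst_iterate_appP, subst_varX,
        isSubterm_iterate_appP] at h1 h2 h3
      obtain rfl := eq_of_unmark_eq_unary h1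
      subst h3
      rcases h2 with h2 | ⟨i, hi, h2⟩
      · exact absurd h2 (MTm.unmark_ne_var _ _)
      · obtain rfl := eq_of_unmark_eq_unary h2
        exact ⟨pair6 i, Or.inr ⟨i, by omega, rfl⟩, π, (rename_pair6 i π).symm⟩
    · exact absurd (isSubterm_var.1 h2) (MTm.unmark_ne_var _ _)
    · exact absurd (isSubterm_var.1 h2) (MTm.unmark_ne_var _ _)
  · rintro ⟨p, ((rfl | rfl) | ⟨i, hi, rfl⟩) | ⟨i, hi, rfl⟩, π, rfl⟩
    · rw [rename_pair3]
      refine ⟨isDefined_fSym, isDefined_fSym, _, Or.inl rfl, π, rfl, ?_, rfl⟩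
      simp only [CRule.rename, subst_appF, subst_iterate_appS, subst_varX, isSubterm_appF]
      exact Or.inl rfl
    · rw [rename_pair4]
      refine ⟨isDefined_fSym, isDefined_fSym, _, Or.inl rfl, π, rfl, ?_, rfl⟩
      simp only [CRule.rename, subst_appF, subst_iterate_appS, subst_varX, isSubterm_appF]
      exact Or.inr (Or.inl rfl)
    · rw [rename_pair5]
      refine ⟨isDefined_fSym, isDefined_sSym, _, Or.inl rfl, π, rfl, ?_, rfl⟩
      simp only [CRule.rename, subst_appF, subst_iterate_appS, subst_varX, isSubterm_appF,
        isSubterm_iterate_appS]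
      exact Or.inr (Or.inr (Or.inr ⟨i, by omega, rfl⟩))
    · rw [rename_pair6]
      refine ⟨isDefined_fSym, isDefined_pSym, _, Or.inr (Or.inl rfl), π, rfl, ?_, rfl⟩
      simp only [CRule.rename, subst_iterate_appP, subst_varX, isSubterm_iterate_appP]
      exact Or.inr ⟨i, by omega, rfl⟩

/-! ### The dependency graph -/

theorem exists_args_of_reflTransGen {F G : FirstOrder.Language.{0, 0}} [G.Structure ℤ]
    {R : Set (CRule F G)} {a b : MTm F G} (h : Relation.ReflTransGen (MStep R) a b) :
    ∃ ts, b = ⟨a.symb, ts⟩ := by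
  induction h with
  | refl => exact ⟨_, rfl⟩
  | tail _ h ih =>
    obtain ⟨ts, rfl⟩ := ih
    cases h
    exact ⟨_, rfl⟩

theorem lhs_eq_of_mem_mcCarthyDP {q : MPair FMc GLIA} (hq : q ∈ mcCarthyDP) :
    q.lhs = ⟨fSym, fun _ => varX⟩ := by
  rcases hq with ((rfl | rfl) | ⟨i, -, rfl⟩) | ⟨i, -, rfl⟩ <;> rfl

/-- Left-hand sides of pairs have the root `f♯`, and rewriting keeps the root, so no pair can follow
one with the right-hand side root `s♯` or `p♯`. -/
theorem mem_of_DGEdge {p q : MPair FMc GLIA} (h : DGEdge mcCarthyDP mcCarthy p q) :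
    p ∈ ({pair3, pair4} : Set _) := by
  obtain ⟨c, σ, rfl, rfl, hc⟩ := h
  obtain ⟨ts, hts⟩ := exists_args_of_reflTransGen (hc.link 0 (by norm_num))
  rw [MTm.subst, lhs_eq_of_mem_mcCarthyDP (hc.mem 1 (by norm_num))] at hts
  have hsymb : (⟨1, fSym⟩ : Σ n, (FMc.sum GLIA).Functions n) =
      ⟨(c 0).rhs.arity, (c 0).rhs.symb⟩ :=
    congrArg (fun m : MTm FMc GLIA => (⟨m.arity, m.symb⟩ : Σ n, (FMc.sum GLIA).Functions n)) hts
  rcases hc.mem 0 (by norm_num) with (h | ⟨i, -, h⟩) | ⟨i, -, h⟩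
  · exact h
  · rw [h] at hsymb
    cases hsymb
  · rw [h] at hsymb
    cases hsymb

theorem satisfies_below101 {t : GLIA.Term ℕ} (ht : ∀ v : ℕ → ℤ, t.realize v < 101) :
    Satisfies (F := FMc) (fun _ => embed t) below101 :=
  ⟨fun _ => t, fun _ _ => rfl, (valid_subst_iff _ _).2 fun v => (realize_below101 _).2 (ht v)⟩

theorem satisfies_not_below101 {t : GLIA.Term ℕ} (ht : ∀ v : ℕ → ℤ, 101 ≤ t.realize v) :
    Satisfies (F := FMc) (fun _ => embed t) below101.not := by
  refine ⟨fun _ => t, fun _ _ => rfl, (valid_subst_iff _ _).2 fun v => ?_⟩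
  rw [Formula.realize_not, realize_below101]
  exact not_lt.2 (ht v)

theorem iterate_appS_embed_numeral (n m : ℕ) :
    appS^[n] (embed (numeral m)) = embed (numeral (n + m)) := by
  induction n with
  | zero => rw [Nat.zero_add]; rfl
  | succ n ih =>
    rw [Function.iterate_succ_apply', ih, numeral, numeral, Nat.succ_add,
      Function.iterate_succ_apply']
    rfl

/-- `p^n(t)` is an interpreted term if `t` is one. -/
theorem exists_embed_eq_iterate_appP (n : ℕ) (t : GLIA.Term ℕ) :
    ∃ u : GLIA.Term ℕ, embed u = appP^[n] (embed t) ∧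
      ∀ v : ℕ → ℤ, u.realize v = t.realize v - n := by
  induction n with
  | zero => exact ⟨t, rfl, fun v => by simp⟩
  | succ n ih =>
    obtain ⟨u, hu, hv⟩ := ih
    refine ⟨Term.func (L := GLIA) LIAFunc.pred fun _ => u, ?_, fun v => ?_⟩
    · rw [Function.iterate_succ_apply', ← hu]
      rfl
    · change u.realize v - 1 = _
      rw [hv]
      push_cast
      ring

theorem mstep_unary {F G : FirstOrder.Language.{0, 0}} [G.Structure ℤ] {R : Set (CRule F G)}
    (g : (F.sum G).Functions 1) {s t : Tm F G} (h : Step R s t) :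
    MStep R ⟨g, fun _ => s⟩ ⟨g, fun _ => t⟩ := by
  have := MStep.below g (fun _ => s) 0 t h
  rwa [update_fin_one] at this

theorem DGEdge_of_link {p q : MPair FMc GLIA} (hp : p ∈ ({pair3, pair4} : Set _))
    (hq : q ∈ ({pair3, pair4} : Set _)) {t u : GLIA.Term ℕ}
    (ht : ∀ v : ℕ → ℤ, t.realize v < 101) (hu : ∀ v : ℕ → ℤ, u.realize v < 101)
    (h : Relation.ReflTransGen (MStep mcCarthy) (p.rhs.subst fun _ => embed t)
      ⟨fSym, fun _ => embed u⟩) : DGEdge mcCarthyDP mcCarthy p q := by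
  have hmem {r : MPair FMc GLIA} (hr : r ∈ ({pair3, pair4} : Set _)) : r ∈ mcCarthyDP :=
    Or.inl (Or.inl hr)
  have hcond {r : MPair FMc GLIA} (hr : r ∈ ({pair3, pair4} : Set _)) : r.cond = below101 := by
    rcases hr with rfl | rfl <;> rfl
  refine ⟨fun i => if i = 0 then p else q, fun i _ => if i = 0 then embed t else embed u,
    rfl, rfl, ?_, ?_, ?_, fun _ _ => terminatingAt_mstep _⟩
  · intro i _
    split_ifs
    exacts [hmem hp, hmem hq]
  · intro i _
    split_ifs
    · rw [hcond hp]
      exact satisfies_below101 ht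
    · rw [hcond hq]
      exact satisfies_below101 hu
  · intro i hi
    obtain rfl : i = 0 := by
      have : i + 1 < 2 := by exact_mod_cast hi
      omega
    have hl : q.lhs.subst (fun _ => embed u) = ⟨fSym, fun _ => embed u⟩ := by
      rw [lhs_eq_of_mem_mcCarthyDP (hmem hq)]
      rfl
    simpa [hl] using h

theorem DGEdge_of_mem {p q : MPair FMc GLIA} (hp : p ∈ ({pair3, pair4} : Set _))
    (hq : q ∈ ({pair3, pair4} : Set _)) : DGEdge mcCarthyDP mcCarthy p q := by
  rcases id hp with h | h
    -- `f(s¹¹(s⁹⁰(0)))` rewrites to `p¹⁰(s¹⁰¹(0))` in one step, whose value `91` is again below `101`.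
  · obtain ⟨u, hu, hv⟩ := exists_embed_eq_iterate_appP 10 (numeral 101)
    refine DGEdge_of_link hp hq (t := numeral 90) (u := u) (fun v => ?_) (fun v => ?_) ?_
    · rw [realize_numeral]; norm_num
    · rw [hv, realize_numeral]; norm_num
    · obtain rfl : p = pair3 := h
      simp only [MTm.subst, pair3, subst_appF, subst_iterate_appS, subst_varX,
        iterate_appS_embed_numeral]
      refine .single (mstep_unary fSym ⟨_, Or.inr (Or.inl rfl), .hole,
        fun _ => embed (numeral 101), satisfies_not_below101 fun v => ?_, rfl, ?_⟩)
      · rw [realize_numeral]; norm_num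
      · rw [hu, subst_iterate_appP, subst_varX]
        rfl
  · refine DGEdge_of_link hp hq (t := numeral 0) (u := numeral 11) (fun v => ?_) (fun v => ?_) ?_
    · rw [realize_numeral]; norm_num
    · rw [realize_numeral]; norm_num
    · obtain rfl : p = pair4 := h
      simp only [MTm.subst, pair4, subst_iterate_appS, subst_varX, iterate_appS_embed_numeral]
      exact .refl

theorem SCCProc_mcCarthyDP : SCCProc mcCarthyDP mcCarthy = {{pair3, pair4}} := by
  have hout {p q : MPair FMc GLIA} (h : Relation.TransGen (DGEdge mcCarthyDP mcCarthy) p q) :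
      p ∈ ({pair3, pair4} : Set _) := by
    obtain ⟨r, h, -⟩ := Relation.TransGen.head'_iff.1 h
    exact mem_of_DGEdge h
  have hscc {p : MPair FMc GLIA} (hp : p ∈ ({pair3, pair4} : Set _)) :
      {q ∈ mcCarthyDP | Relation.TransGen (DGEdge mcCarthyDP mcCarthy) p q ∧
        Relation.TransGen (DGEdge mcCarthyDP mcCarthy) q p} = {pair3, pair4} := by
    ext q
    exact ⟨fun h => hout h.2.2, fun hq => ⟨Or.inl (Or.inl hq), .single (DGEdge_of_mem hp hq),
      .single (DGEdge_of_mem hq hp)⟩⟩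
  ext S'
  constructor
  · rintro ⟨p, -, hp, rfl⟩
    exact hscc (hout hp)
  · rintro rfl
    have h3 : pair3 ∈ ({pair3, pair4} : Set (MPair FMc GLIA)) := Or.inl rfl
    exact ⟨pair3, Or.inl (Or.inl h3), .single (DGEdge_of_mem h3 h3), (hscc h3).symm⟩

/-! ### The polynomial interpretation -/

section LinPI
variable {Pol : LinPI FMc GLIA}

theorem LinPI.eval_eq_evalWith (hf : Pol.plain (n := 1) McFunc.f = ⟨-10, fun _ => 1⟩) (v : ℕ → ℤ)
    (t : Tm FMc GLIA) : Pol.eval v t = evalWith (fun n => n - 10) v t := by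
  induction t with
  | var x => rfl
  | func g ts ih =>
    rcases g with g | g
    · cases g
      rw [LinPI.eval, evalWith, hf, LinPoly.eval]
      simp only [Fin.sum_univ_one, ih]
      ring
    · rw [LinPI.eval.eq_3, evalWith.eq_3, funext ih]

theorem LinPI.meval_fSym (hm : Pol.marked fSym = ⟨-1, fun _ => -1⟩)
    (hf : Pol.plain (n := 1) McFunc.f = ⟨-10, fun _ => 1⟩) (v : ℕ → ℤ) (ts : Fin 1 → Tm FMc GLIA) :
    Pol.meval v ⟨fSym, ts⟩ = -1 - evalWith (fun n => n - 10) v (ts 0) := by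
  rw [LinPI.meval]
  simp only [hm, LinPoly.eval, Fin.sum_univ_one, LinPI.eval_eq_evalWith hf]
  ring

/-- Rewriting does not decrease the value when `f(n)` is interpreted by `n - 10`. -/
theorem evalWith_le_of_step (v : ℕ → ℤ) {s t : Tm FMc GLIA} (h : Step mcCarthy s t) :
    evalWith (fun n => n - 10) v s ≤ evalWith (fun n => n - 10) v t := by
  obtain ⟨ρ, hρ, C, σ, -, rfl, rfl⟩ := h
  induction C with
  | hole =>
    simp only [mcCarthy, Set.mem_insert_iff, Set.mem_singleton_iff] at hρ
    rcases hρ with rfl | rfl | rfl | rfl <;>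
      simp only [Ctx.fill, subst_appF, subst_appS, subst_appP, subst_iterate_appS,
        subst_iterate_appP, evalWith_appF, evalWith_appS, evalWith_appP, evalWith_iterate_appS,
        evalWith_iterate_appP, Nat.cast_ofNat] <;>
      omega
  | arg g i ts C ih =>
    rcases Ctx.fill_arg_cases g i ts C with h | h | h <;>
      simp only [h, evalWith_appF, evalWith_appS, evalWith_appP] <;>
      omega

theorem evalWith_le_of_reflTransGen (v : ℕ → ℤ) {a b : MTm FMc GLIA}
    (h : Relation.ReflTransGen (MStep mcCarthy) a b) :
    evalWith (fun n => n - 10) v a.unmark ≤ evalWith (fun n => n - 10) v b.unmark := by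
  induction h with
  | refl => exact le_rfl
  | tail _ h ih => exact ih.trans (evalWith_le_of_step v h.unmark)

theorem LinPI.meval_pair (hm : Pol.marked fSym = ⟨-1, fun _ => -1⟩)
    (hf : Pol.plain (n := 1) McFunc.f = ⟨-10, fun _ => 1⟩) (v : ℕ → ℤ) {q : MPair FMc GLIA}
    (hq : q ∈ ({pair3, pair4} : Set _)) (σ : Sub FMc GLIA) :
    Pol.meval v (q.lhs.subst σ) = -1 - evalWith (fun n => n - 10) v (σ 0) ∧
    Pol.meval v (q.rhs.subst σ) ≤ -1 - (evalWith (fun n => n - 10) v (σ 0) + 1) := by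
  rcases hq with rfl | rfl
  · simp only [MTm.subst, pair3, LinPI.meval_fSym hm hf, subst_varX, subst_appF, subst_iterate_appS,
      evalWith_appF, evalWith_iterate_appS, Nat.cast_ofNat]
    exact ⟨trivial, by omega⟩
  · simp only [MTm.subst, pair4, LinPI.meval_fSym hm hf, subst_varX, subst_iterate_appS,
      evalWith_iterate_appS, Nat.cast_ofNat]
    exact ⟨trivial, by omega⟩

theorem realize_of_pair {q : MPair FMc GLIA} (hq : q ∈ ({pair3, pair4} : Set _)) {v : ℕ → ℤ}
    (hv : q.cond.Realize v) : v 0 < 101 := by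
  rcases hq with rfl | rfl <;> exact (realize_below101 v).1 hv

/-- The values of the two sides of a pair, the variables taking the values `v`. -/
theorem LinPI.meval_pair_self (hm : Pol.marked fSym = ⟨-1, fun _ => -1⟩)
    (hf : Pol.plain (n := 1) McFunc.f = ⟨-10, fun _ => 1⟩) (v : ℕ → ℤ) {q : MPair FMc GLIA}
    (hq : q ∈ ({pair3, pair4} : Set _)) :
    Pol.meval v q.lhs = -1 - v 0 ∧ Pol.meval v q.rhs < Pol.meval v q.lhs := by
  have hs (m : MTm FMc GLIA) : m.subst Term.var = m := by
    have ht (t : Tm FMc GLIA) : t.subst Term.var = t := by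
      induction t with
      | var x => rfl
      | func g ts ih => exact congrArg (Term.func g) (funext ih)
    simp only [MTm.subst, ht]
  have := LinPI.meval_pair hm hf v hq Term.var
  rw [hs, hs] at this
  obtain ⟨h1, h2⟩ := this
  rw [evalWith] at h1 h2
  omega

/-- Vacuously true: `GLIA` has no binary function symbol. -/
theorem subtractionSafe (t : Tm FMc GLIA) (W : Finset ℕ) : SubtractionSafe t W := nofun

theorem applicable_pairs (hm : Pol.marked fSym = ⟨-1, fun _ => -1⟩)
    (hf : Pol.plain (n := 1) McFunc.f = ⟨-10, fun _ => 1⟩) :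
    Applicable Pol {pair3, pair4} mcCarthy where
  sub_rules _ _ := subtractionSafe _ _
  sub_pairs _ _ _ := subtractionSafe _ _
  plain_nonneg n g i := by
    cases g
    rw [hf]
    exact zero_le_one
  rules_le ρ hρ := by
    rw [validImp_iff]
    intro v hv
    simp only [LinPI.eval_eq_evalWith hf]
    simp only [mcCarthy, Set.mem_insert_iff, Set.mem_singleton_iff] at hρ
    rcases hρ with rfl | rfl | rfl | rfl <;>
      simp only [evalWith_appF, evalWith_appS, evalWith_appP, evalWith_iterate_appS,
        evalWith_iterate_appP, Nat.cast_ofNat] <;>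
      omega
  reducible_nonpos n f i := by
    rintro ⟨l, ts, φ, h | h, -⟩
    · cases h
      rw [hm]
      exact neg_one_lt_zero.le
    · cases h
      rw [hm]
      exact neg_one_lt_zero.le
  pairs_ge q hq := (validImp_iff _ _).2 fun v _ => (LinPI.meval_pair_self hm hf v hq).2.le

theorem strictPairs_eq (hm : Pol.marked fSym = ⟨-1, fun _ => -1⟩)
    (hf : Pol.plain (n := 1) McFunc.f = ⟨-10, fun _ => 1⟩) :
    strictPairs Pol {pair3, pair4} = {pair3, pair4} :=
  Set.Subset.antisymm (fun _ h => h.1) fun _ hq =>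
    ⟨hq, (validImp_iff _ _).2 fun v _ => (LinPI.meval_pair_self hm hf v hq).2⟩

theorem boundedPairs_eq (hm : Pol.marked fSym = ⟨-1, fun _ => -1⟩)
    (hf : Pol.plain (n := 1) McFunc.f = ⟨-10, fun _ => 1⟩) :
    boundedPairs Pol {pair3, pair4} = {pair3, pair4} := by
  obtain ⟨c, hc⟩ := exists_ground_realize (-101)
  refine Set.Subset.antisymm (fun _ h => h.1) fun q hq =>
    ⟨hq, c, (validImp_iff _ _).2 fun v hv => ?_⟩
  rw [hc, (LinPI.meval_pair_self hm hf v hq).1]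
  have := realize_of_pair hq hv
  omega

theorem chain_decreasing (hm : Pol.marked fSym = ⟨-1, fun _ => -1⟩)
    (hf : Pol.plain (n := 1) McFunc.f = ⟨-10, fun _ => 1⟩) {N : ℕ∞} {p : ℕ → MPair FMc GLIA}
    {σ : ℕ → Sub FMc GLIA} (h : IsChain {pair3, pair4} mcCarthy N p σ) (v : ℕ → ℤ) :
    (∀ i : ℕ, (i : ℕ∞) < N →
      Pol.meval v ((p i).lhs.subst (σ i)) > Pol.meval v ((p i).rhs.subst (σ i)) ∧
      -101 ≤ Pol.meval v ((p i).lhs.subst (σ i))) ∧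
    ∀ i : ℕ, ((i + 1 : ℕ) : ℕ∞) < N →
      Pol.meval v ((p i).rhs.subst (σ i)) ≥ Pol.meval v ((p (i + 1)).lhs.subst (σ (i + 1))) := by
  -- All marked terms of the chain have the root `f♯`; on these, `Pol` and `evalWith` of the unmarked
  -- term differ by an order-reversing affine map.
  have hroot (ts : Fin 1 → Tm FMc GLIA) : Pol.meval v ⟨fSym, ts⟩ =
      -11 - evalWith (fun n => n - 10) v (MTm.unmark ⟨fSym, ts⟩) := by
    change _ = -11 - (evalWith (fun n => n - 10) v (ts 0) - 10)
    rw [LinPI.meval_fSym hm hf]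
    ring
  constructor
  · intro i hi
    have hcond : Satisfies (σ i) below101 := by
      have := h.applicable i hi
      rcases h.mem i hi with h | h <;> rwa [h] at this
    have h1 := hcond.lt (fun n => n - 10) v
    have h2 := LinPI.meval_pair hm hf v (h.mem i hi) (σ i)
    omega
  · intro i hi
    have hle := evalWith_le_of_reflTransGen v (h.link i hi)
    have hi' : (i : ℕ∞) < N := lt_of_le_of_lt (by exact_mod_cast i.le_succ) hi
    have hl : Pol.meval v ((p (i + 1)).lhs.subst (σ (i + 1))) = -11 -
        evalWith (fun n => n - 10) v ((p (i + 1)).lhs.subst (σ (i + 1))).unmark := by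
      rcases h.mem (i + 1) hi with h | h <;> rw [h] <;> exact hroot _
    have hr : Pol.meval v ((p i).rhs.subst (σ i)) = -11 -
        evalWith (fun n => n - 10) v ((p i).rhs.subst (σ i)).unmark := by
      rcases h.mem i hi' with h | h <;> rw [h] <;> exact hroot _
    rw [hl, hr]
    omega

end LinPI

end CTRS

theorem mainTheorem2 :
    -- `R₁` is terminating
    CTRS.Terminating CTRS.mcCarthy ∧
    -- the dependency pairs of `R₁` are (3)–(6), up to renaming of variables
    CTRS.DP CTRS.mcCarthy = {q | ∃ p ∈ CTRS.mcCarthyDP, ∃ π : Equiv.Perm ℕ, q = p.rename π} ∧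
    -- the decomposition into strongly connected components leaves `{(3), (4)}`
    CTRS.SCCProc CTRS.mcCarthyDP CTRS.mcCarthy = {{CTRS.pair3, CTRS.pair4}} ∧
    -- the claims on the interpretation with `Pol(f♯) = -1 - x₁` and `Pol(f) = -10 + x₁`
    (∀ Pol : CTRS.LinPI CTRS.FMc CTRS.GLIA,
      Pol.marked CTRS.fSym = ⟨-1, fun _ => -1⟩ →
      Pol.plain (n := 1) CTRS.McFunc.f = ⟨-10, fun _ => 1⟩ →
      CTRS.Applicable Pol {CTRS.pair3, CTRS.pair4} CTRS.mcCarthy ∧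
      CTRS.strictPairs Pol {CTRS.pair3, CTRS.pair4} = {CTRS.pair3, CTRS.pair4} ∧
      CTRS.boundedPairs Pol {CTRS.pair3, CTRS.pair4} = {CTRS.pair3, CTRS.pair4} ∧
      CTRS.PIProc Pol {CTRS.pair3, CTRS.pair4} = {∅} ∧
      -- ground chains become decreasing sequences, strictly decreasing at each pair, with a common
      -- lower bound
      ∃ c : ℤ, ∀ (N : ℕ∞) (p : ℕ → CTRS.MPair CTRS.FMc CTRS.GLIA)
        (σ : ℕ → CTRS.Sub CTRS.FMc CTRS.GLIA),
        CTRS.IsGroundChain {CTRS.pair3, CTRS.pair4} CTRS.mcCarthy N p σ →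
        ∀ v : ℕ → ℤ,
          (∀ i : ℕ, (i : ℕ∞) < N →
            Pol.meval v ((p i).lhs.subst (σ i)) > Pol.meval v ((p i).rhs.subst (σ i)) ∧
            c ≤ Pol.meval v ((p i).lhs.subst (σ i))) ∧
          (∀ i : ℕ, ((i + 1 : ℕ) : ℕ∞) < N →
            Pol.meval v ((p i).rhs.subst (σ i)) ≥
              Pol.meval v ((p (i + 1)).lhs.subst (σ (i + 1))))) ∧
    -- there is no infinite `({(3), (4)}, R₁)`-chain, ground or not
    CTRS.FiniteDP {CTRS.pair3, CTRS.pair4} CTRS.mcCarthy := by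
  refine ⟨CTRS.terminating_mcCarthy, CTRS.DP_mcCarthy, CTRS.SCCProc_mcCarthyDP, ?_,
    CTRS.finiteDP_pairs⟩
  intro Pol hm hf
  refine ⟨CTRS.applicable_pairs hm hf, CTRS.strictPairs_eq hm hf, CTRS.boundedPairs_eq hm hf, ?_,
    -101, fun N p σ h v => CTRS.chain_decreasing hm hf h.1 v⟩
  rw [CTRS.PIProc, CTRS.strictPairs_eq hm hf, CTRS.boundedPairs_eq hm hf, Set.sdiff_self,
    Set.pair_eq_singleton]
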